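/- Let $s\ge 2$. There is a constant $c_s>0$, depending only on $s$, such that the following holds. Let $M\ge 1$ and let $P_M=\{\boldsymbol{x}_0,\dots,\boldsymbol{x}_{M-1}\}$ be an arbitrary point set (repetitions allowed) in $[0,1]^s$. Then there exists a concave unnormalized density $\psi:[0,1]^{s-1}\to[0,\infty)$, that is, a concave function with $C:=\int_{[0,1]^{s-1}}\psi(\boldsymbol{z})\,d\boldsymbol{z}>0$, such that, with $L:=\sup_{[0,1]^{s-1}}\psi<\infty$, the acceptance-rejection algorithm, which accepts $\boldsymbol{x}_n=(x_{n,1},\dots,x_{n,s})$ if and only if $\psi(x_{n,1},\dots,x_{n,s-1})\ge L\,x_{n,s}$, accepts $N\ge 1$ of the points, and the projections $\boldsymbol{y}_0,\dots,\boldsymbol{y}_{N-1}\in[0,1]^{s-1}$ of the accepted points onto the first $s-1$ coordinates satisfy $$D^*_{N,\psi}:=\sup_{\boldsymbol{t}\in[0,1]^{s-1}}\left|\frac1N\sum_{n=0}^{N-1}1_{[\boldsymbol{0},\boldsymbol{t})}(\boldsymbol{y}_n)-\frac1C\int_{[\boldsymbol{0},\boldsymbol{t})}\psi(\boldsymbol{z})\,d\boldsymbol{z}\right|\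 \ge\ c_s\,N^{-\frac{2}{s+1}},$$ where $[\boldsymbol{0},\boldsymbol{t})=\prod_{j=1}^{s-1}[0,t_j)$. -/

import Mathlib

open MeasureTheory

noncomputable section

/-- The closed unit cube `[0,1]^d`. -/
def unitCube (d : ℕ) : Set (Fin d → ℝ) := Set.Icc 0 1

/-- The half-open box `[0,t) = ∏ j, [0, t j)` anchored at the origin. -/
def anchoredBox {d : ℕ} (t : Fin d → ℝ) : Set (Fin d → ℝ) :=
  Set.univ.pi fun j => Set.Ico (0 : ℝ) (t j)

/-- An (unnormalized) density on `[0,1]^d`: nonnegative, integrable, of positive total mass. -/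
structure IsUnnormalizedDensity {d : ℕ} (ψ : (Fin d → ℝ) → ℝ) : Prop where
  nonneg : ∀ z ∈ unitCube d, 0 ≤ ψ z
  integrableOn : IntegrableOn ψ (unitCube d)
  integral_pos : 0 < ∫ z in unitCube d, ψ z

/-- The local discrepancy at `t` of the finite family `y` with respect to the density `ψ`. -/
def localDiscrepancy {d : ℕ} {ι : Type*} [Fintype ι] (ψ : (Fin d → ℝ) → ℝ)
    (y : ι → Fin d → ℝ) (t : Fin d → ℝ) : ℝ :=
  (1 / (Fintype.card ι : ℝ)) * ∑ n, (anchoredBox t).indicator (fun _ => (1 : ℝ)) (y n)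
    - (1 / ∫ z in unitCube d, ψ z) * ∫ z in anchoredBox t, ψ z

/-- The star discrepancy of the finite family `y` of points of `[0,1]^d` with respect to `ψ`. -/
def starDiscrepancy {d : ℕ} {ι : Type*} [Fintype ι] (ψ : (Fin d → ℝ) → ℝ)
    (y : ι → Fin d → ℝ) : ℝ :=
  ⨆ t : unitCube d, |localDiscrepancy ψ y t|

/-- The first `d` coordinates of a point of `ℝ^(d+1)`. -/
def firstCoords {d : ℕ} (p : Fin (d + 1) → ℝ) : Fin d → ℝ := fun j => p j.castSucc

/-- The indices of the driver points accepted by the acceptance-rejection algorithm with target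
density `ψ` and bounding constant `L`. -/
def accepted {d M : ℕ} (ψ : (Fin d → ℝ) → ℝ) (L : ℝ) (x : Fin M → Fin (d + 1) → ℝ) :
    Finset (Fin M) :=
  Finset.univ.filter fun n => L * x n (Fin.last d) ≤ ψ (firstCoords (x n))

/-- The samples returned by the algorithm: the accepted driver points, projected to `[0,1]^d`. -/
def samples {d M : ℕ} (ψ : (Fin d → ℝ) → ℝ) (L : ℝ) (x : Fin M → Fin (d + 1) → ℝ) :
    accepted ψ L x → Fin d → ℝ :=
  fun n => firstCoords (x n)

end

/-!
A concave density is built that equals `1` on the half cube `z j₀ ≤ 1 / 2` and is modified, outside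
that half, according to the driver points. Let `m` be the number of driver points lying above the
box `[0, t)` with corner `t = (1, …, 1 / 2, …, 1)`. If `ψ = 1` on that box and `L = 1`, all these
`m` points are accepted, so the local discrepancy at `t` is `m / N - (1 / 2) / C`, where only the
number `N` of accepted points and the mass `C` depend on the rest of `ψ`
(`localDiscrepancy_halfCorner`).

If `m = 0`, the density `ψ = 1` accepts everything and has discrepancy at least `1 / 2`. Otherwise
take the paraboloid `dome` truncated at height `1`, and cut off caps of it by hyperplanes: the caps
sit over disjoint balls of radius `3 / (16 k)` centred at the `k ^ d` points of a grid in
`[5 / 8, 1] ^ d`, with `k = ⌈m ^ (1 / (d + 2))⌉`, so that each cap has volume at least a constant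
times `1 / m` and at most `1 / (4 m)`. For a set `A` of caps, the minimum `cutDome j₀ A` of the
truncated dome and the cutting planes is again concave. Either half of the caps contain no
accepted point, or half of them contain at least one (`exists_caps`). Removing that half leaves `N`
unchanged but lowers `C` in the first case, and in the second lowers `N` by more than the loss in
`C` can compensate. In both cases `N / 2 - m C` changes by at least a constant times
`k ^ d ≥ m ^ (d / (d + 2))`, so one of the two densities, cut or uncut, has discrepancy at least a
constant times `m ^ (d / (d + 2) - 1) = m ^ (-2 / (d + 2))`. As all the densities accept the `m`
points above the box, `N ≥ m`, and the bound in terms of `N` follows.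
-/

/-! ### Cutting caps off a paraboloid -/

/-- The radius of the balls over which the caps lie. It is chosen so that `k` adjacent intervals of
length `2 * capRadius k` fill `[5 / 8, 1]`. -/
noncomputable def capRadius (k : ℕ) : ℝ := 3 / (16 * k)

/-- The centres of the caps: the midpoints of the `k ^ d` cells of a grid in `[5 / 8, 1] ^ d`. -/
noncomputable def capCenter {d k : ℕ} (i : Fin d → Fin k) (j : Fin d) : ℝ :=
  5 / 8 + (2 * ((i j : ℕ) : ℝ) + 1) * capRadius k

/-- A concave paraboloid. On `unitCube d` it is at least `1 / 2`; it is at least `1` where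
`z j₀ ≤ 1 / 2` and at most `1` where `5 / 8 ≤ z j₀`. -/
noncomputable def dome {d : ℕ} (j₀ : Fin d) (z : Fin d → ℝ) : ℝ :=
  1 + (5 / 8 - z j₀) - (∑ j, (z j - 1 / 2) ^ 2) / (2 * d)

/-- The affine function cutting off the cap with index `i`: it lies below `dome` exactly on the open
Euclidean ball with centre `capCenter i` and radius `capRadius k`. It is written as a modification
of `dome`, whose quadratic part cancels. -/
noncomputable def capPlane {d k : ℕ} (j₀ : Fin d) (i : Fin d → Fin k) (z : Fin d → ℝ) : ℝ :=
  dome j₀ z + (∑ j, (z j - capCenter i j) ^ 2 - capRadius k ^ 2) / (2 * d)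

/-- The dome truncated at height `1`, with the caps in `A` cut off. -/
noncomputable def cutDome {d k : ℕ} (j₀ : Fin d) (A : Finset (Fin d → Fin k))
    (z : Fin d → ℝ) : ℝ :=
  A.fold min (min 1 (dome j₀ z)) fun i => capPlane j₀ i z

/-- The closed cube with centre `capCenter i` and half-side `r` (a ball for the sup norm). For
`r = capRadius k` it contains the ball under the cap; for `r = capRadius k / (2 * d)` it lies in the
concentric ball of half the radius, where the cap still has at least half its height. -/
def capCube {d k : ℕ} (i : Fin d → Fin k) (r : ℝ) : Set (Fin d → ℝ) :=
  Metric.closedBall (capCenter i) r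

section Cap

variable {d k : ℕ} {j₀ : Fin d}

lemma le_cutDome {A : Finset (Fin d → Fin k)} {z : Fin d → ℝ} {c : ℝ} :
    c ≤ cutDome j₀ A z ↔ (c ≤ 1 ∧ c ≤ dome j₀ z) ∧ ∀ i ∈ A, c ≤ capPlane j₀ i z := by
  rw [cutDome, Finset.le_fold_min, le_min_iff]

lemma cutDome_le_one (A : Finset (Fin d → Fin k)) (z : Fin d → ℝ) : cutDome j₀ A z ≤ 1 :=
  (le_cutDome.1 le_rfl).1.1

lemma cutDome_empty (z : Fin d → ℝ) :
    cutDome j₀ (∅ : Finset (Fin d → Fin k)) z = min 1 (dome j₀ z) := rfl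

lemma cutDome_anti {A B : Finset (Fin d → Fin k)} (h : A ⊆ B) (z : Fin d → ℝ) :
    cutDome j₀ B z ≤ cutDome j₀ A z :=
  le_cutDome.2 ⟨(le_cutDome.1 le_rfl).1, fun i hi => (le_cutDome.1 le_rfl).2 i (h hi)⟩

lemma continuous_dome : Continuous (dome j₀) := by
  unfold dome; fun_prop

lemma continuous_capPlane (i : Fin d → Fin k) : Continuous (capPlane j₀ i) := by
  have := continuous_dome (j₀ := j₀)
  unfold capPlane; fun_prop

lemma continuous_cutDome (A : Finset (Fin d → Fin k)) : Continuous (cutDome j₀ A) := by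
  classical
  induction A using Finset.induction_on with
  | empty => exact continuous_const.min continuous_dome
  | insert i A hi ih =>
    have : cutDome j₀ (insert i A) = fun z => min (capPlane j₀ i z) (cutDome j₀ A z) := by
      funext z
      rw [cutDome, Finset.fold_insert hi]; rfl
    rw [this]
    exact (continuous_capPlane i).min ih

lemma concaveOn_dome (s : Set (Fin d → ℝ)) (hs : Convex ℝ s) : ConcaveOn ℝ s (dome j₀) := by
  refine ⟨hs, fun x _ y _ a b ha hb hab => ?_⟩
  have key : ∑ j, (a * x j + b * y j - 1 / 2) ^ 2 ≤
      a * ∑ j, (x j - 1 / 2) ^ 2 + b * ∑ j, (y j - 1 / 2) ^ 2 := by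
    rw [Finset.mul_sum, Finset.mul_sum, ← Finset.sum_add_distrib]
    refine Finset.sum_le_sum fun j _ => ?_
    obtain rfl : b = 1 - a := by linarith
    nlinarith [mul_nonneg (mul_nonneg ha hb) (sq_nonneg (x j - y j))]
  have h2 := div_le_div_of_nonneg_right key (by positivity : (0 : ℝ) ≤ 2 * d)
  simp only [dome, smul_eq_mul, Pi.add_apply, Pi.smul_apply]
  obtain rfl : b = 1 - a := by linarith
  rw [add_div, mul_div_assoc, mul_div_assoc] at h2
  linarith

/-- The quadratic parts cancel, so that a cutting plane is affine. -/
lemma concaveOn_capPlane (i : Fin d → Fin k) (s : Set (Fin d → ℝ)) (hs : Convex ℝ s) :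
    ConcaveOn ℝ s (capPlane j₀ i) := by
  refine ⟨hs, fun x _ y _ a b ha hb hab => le_of_eq ?_⟩
  have aff (z : Fin d → ℝ) : capPlane j₀ i z = 13 / 8 - z j₀ +
      (∑ j, ((1 - 2 * capCenter i j) * z j + (capCenter i j ^ 2 - 1 / 4)) - capRadius k ^ 2)
        / (2 * d) := by
    have : ∑ j, ((1 - 2 * capCenter i j) * z j + (capCenter i j ^ 2 - 1 / 4)) =
        ∑ j, (z j - capCenter i j) ^ 2 - ∑ j, (z j - 1 / 2) ^ 2 := by
      rw [← Finset.sum_sub_distrib]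
      exact Finset.sum_congr rfl fun j _ => by ring
    rw [this, capPlane, dome]; ring
  have lin : ∑ j, ((1 - 2 * capCenter i j) * (a * x j + b * y j) + (capCenter i j ^ 2 - 1 / 4)) =
      a * ∑ j, ((1 - 2 * capCenter i j) * x j + (capCenter i j ^ 2 - 1 / 4)) +
      b * ∑ j, ((1 - 2 * capCenter i j) * y j + (capCenter i j ^ 2 - 1 / 4)) := by
    rw [Finset.mul_sum, Finset.mul_sum, ← Finset.sum_add_distrib]
    refine Finset.sum_congr rfl fun j _ => ?_
    obtain rfl : b = 1 - a := by linarith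
    ring
  simp only [aff, smul_eq_mul, Pi.add_apply, Pi.smul_apply]
  rw [lin]
  obtain rfl : b = 1 - a := by linarith
  ring

lemma concaveOn_cutDome (A : Finset (Fin d → Fin k)) (s : Set (Fin d → ℝ)) (hs : Convex ℝ s) :
    ConcaveOn ℝ s (cutDome j₀ A) := by
  refine ⟨hs, fun x hx y hy a b ha hb hab => ?_⟩
  have hX := (le_cutDome (j₀ := j₀) (A := A) (z := x)).1 le_rfl
  have hY := (le_cutDome (j₀ := j₀) (A := A) (z := y)).1 le_rfl
  simp only [smul_eq_mul]
  refine le_cutDome.2 ⟨⟨?_, ?_⟩, fun i hi => ?_⟩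
  · nlinarith [hX.1.1, hY.1.1]
  · refine le_trans ?_ ((concaveOn_dome s hs).2 hx hy ha hb hab)
    exact add_le_add (mul_le_mul_of_nonneg_left hX.1.2 ha) (mul_le_mul_of_nonneg_left hY.1.2 hb)
  · refine le_trans ?_ ((concaveOn_capPlane i s hs).2 hx hy ha hb hab)
    exact add_le_add (mul_le_mul_of_nonneg_left (hX.2 i hi) ha)
      (mul_le_mul_of_nonneg_left (hY.2 i hi) hb)

lemma capRadius_pos (hk : 0 < k) : 0 < capRadius k := by
  unfold capRadius; positivity

lemma capRadius_le (hk : 0 < k) : capRadius k ≤ 3 / 16 := by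
  unfold capRadius
  have : (1 : ℝ) ≤ k := by exact_mod_cast hk
  rw [div_le_div_iff₀ (by positivity) (by norm_num)]
  linarith

lemma five_eighths_add_le_capCenter (i : Fin d → Fin k) (j : Fin d) :
    5 / 8 + capRadius k ≤ capCenter i j := by
  have hk : 0 < k := (i j).pos
  have := capRadius_pos hk
  unfold capCenter
  nlinarith [mul_nonneg (Nat.cast_nonneg (α := ℝ) (i j : ℕ)) this.le]

lemma capCenter_add_le_one (i : Fin d → Fin k) (j : Fin d) :
    capCenter i j + capRadius k ≤ 1 := by
  have hk : 0 < k := (i j).pos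
  have h1 : ((i j : ℕ) : ℝ) + 1 ≤ k := by exact_mod_cast (i j).isLt
  have h2 : k * capRadius k = 3 / 16 := by
    unfold capRadius
    have : (k : ℝ) ≠ 0 := by positivity
    field_simp
  have := mul_le_mul_of_nonneg_right h1 (capRadius_pos hk).le
  unfold capCenter
  linarith

/-- The open cubes of the grid are pairwise disjoint. -/
lemma eq_of_abs_sub_capCenter_lt {i i' : Fin d → Fin k} {z : Fin d → ℝ}
    (h : ∀ j, |z j - capCenter i j| < capRadius k)
    (h' : ∀ j, |z j - capCenter i' j| < capRadius k) : i = i' := by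
  funext j
  have hr := capRadius_pos (i j).pos
  have h1 := abs_lt.1 (h j)
  have h2 := abs_lt.1 (h' j)
  simp only [capCenter] at h1 h2
  have a1 : ((i j : ℕ) : ℝ) < (i' j : ℕ) + 1 := by
    by_contra hc
    nlinarith
  have a2 : ((i' j : ℕ) : ℝ) < (i j : ℕ) + 1 := by
    by_contra hc
    nlinarith
  have a1 : (i j : ℕ) < (i' j : ℕ) + 1 := by exact_mod_cast a1
  have a2 : (i' j : ℕ) < (i j : ℕ) + 1 := by exact_mod_cast a2
  exact Fin.ext (by omega)

lemma abs_sub_lt_of_capPlane_lt {i : Fin d → Fin k} {z : Fin d → ℝ}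
    (h : capPlane j₀ i z < dome j₀ z) (j : Fin d) : |z j - capCenter i j| < capRadius k := by
  have hd : (0 : ℝ) < 2 * d := by have := j.pos; positivity
  have h1 : (∑ j, (z j - capCenter i j) ^ 2 - capRadius k ^ 2) / (2 * d) < 0 := by
    unfold capPlane at h; linarith
  have h2 : ∑ j, (z j - capCenter i j) ^ 2 < capRadius k ^ 2 := by
    by_contra hc
    exact absurd h1 (not_lt.2 (div_nonneg (by linarith) hd.le))
  have h3 := Finset.single_le_sum (f := fun j => (z j - capCenter i j) ^ 2)
    (fun j _ => sq_nonneg _) (Finset.mem_univ j)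
  exact abs_lt_of_sq_lt_sq (h3.trans_lt h2) (capRadius_pos (i j).pos).le

lemma sum_sq_sub_half_le {z : Fin d → ℝ} (hz : z ∈ unitCube d) :
    (∑ j, (z j - 1 / 2) ^ 2) / (2 * (d : ℝ)) ≤ 1 / 8 := by
  have h : ∑ j, (z j - 1 / 2) ^ 2 ≤ ∑ _j : Fin d, (1 / 4 : ℝ) := by
    refine Finset.sum_le_sum fun j _ => ?_
    have h0 := hz.1 j
    have h1 := hz.2 j
    simp only [Pi.zero_apply, Pi.one_apply] at h0 h1
    nlinarith
  simp only [Finset.sum_const, Finset.card_univ, Fintype.card_fin, nsmul_eq_mul] at h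
  exact div_le_of_le_mul₀ (by positivity) (by norm_num) (by linarith)

lemma half_le_dome {z : Fin d → ℝ} (hz : z ∈ unitCube d) : 1 / 2 ≤ dome j₀ z := by
  have h := sum_sq_sub_half_le hz
  have h1 := hz.2 j₀
  simp only [Pi.one_apply] at h1
  unfold dome
  linarith

lemma one_le_dome {z : Fin d → ℝ} (hz : z ∈ unitCube d) (h : z j₀ ≤ 1 / 2) :
    1 ≤ dome j₀ z := by
  have h := sum_sq_sub_half_le hz
  unfold dome
  linarith

lemma dome_le_one {z : Fin d → ℝ} (h : 5 / 8 ≤ z j₀) : dome j₀ z ≤ 1 := by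
  have : 0 ≤ (∑ j, (z j - 1 / 2) ^ 2) / (2 * (d : ℝ)) :=
    div_nonneg (Finset.sum_nonneg fun _ _ => sq_nonneg _) (by positivity)
  unfold dome
  linarith

/-- A cap has height `capRadius k ^ 2 / (2 * d)`. -/
lemma dome_sub_le_capPlane (i : Fin d → Fin k) (z : Fin d → ℝ) :
    dome j₀ z - capRadius k ^ 2 / (2 * d) ≤ capPlane j₀ i z := by
  have : 0 ≤ (∑ j, (z j - capCenter i j) ^ 2) / (2 * d) :=
    div_nonneg (Finset.sum_nonneg fun _ _ => sq_nonneg _) (by positivity)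
  unfold capPlane
  rw [sub_div]
  linarith

lemma cutDome_nonneg (A : Finset (Fin d → Fin k)) {z : Fin d → ℝ} (hz : z ∈ unitCube d) :
    0 ≤ cutDome j₀ A z := by
  have h := half_le_dome (j₀ := j₀) hz
  refine le_cutDome.2 ⟨⟨zero_le_one, by linarith⟩, fun i _ => ?_⟩
  refine le_trans ?_ (dome_sub_le_capPlane i z)
  have h1 := capRadius_le (i j₀).pos
  have h0 := capRadius_pos (i j₀).pos
  have hd : (1 : ℝ) ≤ d := by exact_mod_cast j₀.pos
  have : capRadius k ^ 2 / (2 * d) ≤ 1 / 2 :=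
    div_le_of_le_mul₀ (by positivity) (by norm_num) (by nlinarith)
  linarith

lemma cutDome_eq_one (A : Finset (Fin d → Fin k)) {z : Fin d → ℝ} (hz : z ∈ unitCube d)
    (h : z j₀ ≤ 1 / 2) : cutDome j₀ A z = 1 := by
  have hdome := one_le_dome hz h
  refine le_antisymm (cutDome_le_one A z) (le_cutDome.2 ⟨⟨le_rfl, hdome⟩, fun i _ => ?_⟩)
  by_contra hc
  have h1 := (abs_lt.1 (abs_sub_lt_of_capPlane_lt (j₀ := j₀) (i := i) (z := z)
    (by linarith) j₀)).1
  have := five_eighths_add_le_capCenter i j₀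
  linarith

/-! ### The volume of the removed caps -/

lemma capCube_subset (i : Fin d → Fin k) {r : ℝ} (hr : r ≤ capRadius k) :
    capCube i r ⊆ unitCube d := by
  intro z hz
  have h (j : Fin d) := (dist_le_pi_dist z (capCenter i) j).trans (Metric.mem_closedBall.1 hz)
  constructor <;> intro j
  · have := abs_le.1 ((Real.dist_eq _ _).symm.trans_le (h j))
    have h2 := five_eighths_add_le_capCenter i j
    simp only [Pi.zero_apply]; linarith
  · have := abs_le.1 ((Real.dist_eq _ _).symm.trans_le (h j))
    have h2 := capCenter_add_le_one i j
    simp only [Pi.one_apply]; linarith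

lemma volume_capCube (i : Fin d → Fin k) {r : ℝ} (hr : 0 ≤ r) :
    volume.real (capCube i r) = (2 * r) ^ d := by
  rw [Measure.real, capCube, Real.volume_pi_closedBall _ hr,
    ENNReal.toReal_ofReal (by positivity), Fintype.card_fin]

lemma integral_sum_indicator_capCube (A : Finset (Fin d → Fin k)) {r : ℝ} (hr : 0 ≤ r)
    (hrk : r ≤ capRadius k) (c : ℝ) :
    ∫ z in unitCube d, ∑ i ∈ A, (capCube i r).indicator (fun _ => c) z =
      A.card * (c * (2 * r) ^ d) := by
  have hm (i : Fin d → Fin k) : MeasurableSet (capCube i r) :=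
    Metric.isClosed_closedBall.measurableSet
  rw [integral_finsetSum]
  · simp_rw [integral_indicator (hm _), Measure.restrict_restrict (hm _)]
    rw [← nsmul_eq_mul, ← Finset.sum_const]
    refine Finset.sum_congr rfl fun i _ => ?_
    rw [Set.inter_eq_self_of_subset_left (capCube_subset i hrk), setIntegral_const,
      volume_capCube i hr, smul_eq_mul, mul_comm]
  · intro i _
    exact (integrable_indicator_iff (hm i)).2
      (integrableOn_const (((Measure.restrict_apply_le _ _).trans_lt
        (isCompact_closedBall _ _).measure_lt_top).ne))

lemma integrableOn_sum_indicator_capCube (A : Finset (Fin d → Fin k)) (r c : ℝ) :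
    IntegrableOn (fun z => ∑ i ∈ A, (capCube i r).indicator (fun _ => c) z) (unitCube d) := by
  have hm (i : Fin d → Fin k) : MeasurableSet (capCube i r) :=
    Metric.isClosed_closedBall.measurableSet
  refine integrable_finsetSum _ fun i _ => ?_
  exact (integrable_indicator_iff (hm i)).2
      (integrableOn_const (((Measure.restrict_apply_le _ _).trans_lt
        (isCompact_closedBall _ _).measure_lt_top).ne))

lemma integrableOn_cutDome (A : Finset (Fin d → Fin k)) :
    IntegrableOn (cutDome j₀ A) (unitCube d) :=
  (continuous_cutDome A).continuousOn.integrableOn_compact isCompact_Icc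

lemma cutDome_empty_sub_le (A : Finset (Fin d → Fin k)) (z : Fin d → ℝ) :
    cutDome j₀ (∅ : Finset (Fin d → Fin k)) z - ∑ i ∈ A, (capCube i (capRadius k)).indicator
      (fun _ => capRadius k ^ 2 / (2 * d)) z ≤ cutDome j₀ A z := by
  have hn (i : Fin d → Fin k) : 0 ≤ (capCube i (capRadius k)).indicator
      (fun _ => capRadius k ^ 2 / (2 * d : ℝ)) z :=
    Set.indicator_nonneg (fun _ _ => by positivity) _
  have hs := Finset.sum_nonneg fun i (_ : i ∈ A) => hn i
  obtain ⟨⟨h1, h2⟩, -⟩ := (le_cutDome (j₀ := j₀) (A := (∅ : Finset (Fin d → Fin k)))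
    (z := z)).1 le_rfl
  refine le_cutDome.2 ⟨⟨by linarith, by linarith⟩, fun i hi => ?_⟩
  by_cases hc : dome j₀ z ≤ capPlane j₀ i z
  · linarith
  · have hz : z ∈ capCube i (capRadius k) :=
      (dist_pi_le_iff (capRadius_pos (i j₀).pos).le).2 fun j =>
        (abs_sub_lt_of_capPlane_lt (not_le.1 hc) j).le
    have h3 := Finset.single_le_sum (fun i _ => hn i) hi
    rw [Set.indicator_of_mem hz] at h3
    have := dome_sub_le_capPlane (j₀ := j₀) i z
    linarith

/-- Each removed cap costs at most the volume of the box enclosing it. -/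
lemma integral_cutDome_ge (A : Finset (Fin d → Fin k)) (hk : 0 < k) :
    (∫ z in unitCube d, cutDome j₀ (∅ : Finset (Fin d → Fin k)) z) -
      A.card * (capRadius k ^ 2 / (2 * d) * (2 * capRadius k) ^ d) ≤
      ∫ z in unitCube d, cutDome j₀ A z := by
  rw [← integral_sum_indicator_capCube A (capRadius_pos hk).le le_rfl,
    ← integral_sub (integrableOn_cutDome _) (integrableOn_sum_indicator_capCube A _ _)]
  exact integral_mono ((integrableOn_cutDome _).sub (integrableOn_sum_indicator_capCube A _ _))
    (integrableOn_cutDome A) fun z => cutDome_empty_sub_le A z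

lemma cutDome_le_empty_sub (A : Finset (Fin d → Fin k)) (z : Fin d → ℝ) :
    cutDome j₀ A z ≤ cutDome j₀ (∅ : Finset (Fin d → Fin k)) z -
      ∑ i ∈ A, (capCube i (capRadius k / (2 * d))).indicator
        (fun _ => capRadius k ^ 2 / (4 * d)) z := by
  have hd : (1 : ℝ) ≤ d := by exact_mod_cast j₀.pos
  by_cases h : ∃ i ∈ A, z ∈ capCube i (capRadius k / (2 * d))
  · obtain ⟨i, hi, hz⟩ := h
    have hr := capRadius_pos (i j₀).pos
    have hle : capRadius k / (2 * d) < capRadius k := div_lt_self hr (by linarith)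
    have key (i : Fin d → Fin k) (hz : z ∈ capCube i (capRadius k / (2 * d))) (j : Fin d) :
        |z j - capCenter i j| ≤ capRadius k / (2 * d) :=
      (dist_pi_le_iff (by positivity)).1 (Metric.mem_closedBall.1 hz) j
    rw [Finset.sum_eq_single_of_mem i hi, Set.indicator_of_mem hz]
    · have h5 : 5 / 8 ≤ z j₀ := by
        have := (abs_le.1 (key i hz j₀)).1
        have := five_eighths_add_le_capCenter i j₀
        linarith
      rw [cutDome_empty, min_eq_right (dome_le_one h5)]
      refine ((le_cutDome.1 le_rfl).2 i hi).trans ?_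
      have hs : ∑ j, (z j - capCenter i j) ^ 2 ≤ ∑ _j : Fin d, (capRadius k / (2 * d)) ^ 2 :=
        Finset.sum_le_sum fun j _ => sq_le_sq.2 ((key i hz j).trans (le_abs_self _))
      simp only [Finset.sum_const, Finset.card_univ, Fintype.card_fin, nsmul_eq_mul] at hs
      have hs2 : (d : ℝ) * (capRadius k / (2 * d)) ^ 2 ≤ capRadius k ^ 2 / 2 := by
        rw [show (d : ℝ) * (capRadius k / (2 * d)) ^ 2 = capRadius k ^ 2 / (4 * d) by
          field_simp; norm_num]
        exact div_le_div_of_nonneg_left (by positivity) (by norm_num) (by linarith)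
      have h3 := div_le_div_of_nonneg_right
        (show ∑ j, (z j - capCenter i j) ^ 2 - capRadius k ^ 2 ≤ - (capRadius k ^ 2 / 2) by
          linarith)
        (show (0 : ℝ) ≤ 2 * d by positivity)
      have h4 : - (capRadius k ^ 2 / 2) / (2 * d) = - (capRadius k ^ 2 / (4 * d)) := by
        field_simp; norm_num
      unfold capPlane
      linarith
    · intro i' _ hne
      refine Set.indicator_of_notMem (fun hz' => hne ?_) _
      exact eq_of_abs_sub_capCenter_lt (fun j => (key i' hz' j).trans_lt hle)
        (fun j => (key i hz j).trans_lt hle)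
  · push Not at h
    rw [Finset.sum_eq_zero fun i hi => Set.indicator_of_notMem (h i hi) _, sub_zero]
    exact cutDome_anti (Finset.empty_subset A) z

/-- Each removed cap costs at least the volume of a box inscribed in it; disjointness of the caps
enters here. -/
lemma integral_cutDome_le (A : Finset (Fin d → Fin k)) (hk : 0 < k) :
    ∫ z in unitCube d, cutDome j₀ A z ≤
    (∫ z in unitCube d, cutDome j₀ (∅ : Finset (Fin d → Fin k)) z) -
      A.card * (capRadius k ^ 2 / (4 * d) * (capRadius k / d) ^ d) := by
  have hd : (1 : ℝ) ≤ d := by exact_mod_cast j₀.pos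
  have hr := capRadius_pos hk
  have h2 : capRadius k / d = 2 * (capRadius k / (2 * d)) := by field_simp
  rw [h2, ← integral_sum_indicator_capCube A (by positivity)
    (div_le_self hr.le (by linarith)),
    ← integral_sub (integrableOn_cutDome _) (integrableOn_sum_indicator_capCube A _ _)]
  exact integral_mono (integrableOn_cutDome A)
    ((integrableOn_cutDome _).sub (integrableOn_sum_indicator_capCube A _ _))
    fun z => cutDome_le_empty_sub A z

end Cap

/-! ### The star discrepancy of a density -/

section Discrepancy

variable {d : ℕ}

lemma anchoredBox_subset_unitCube {t : Fin d → ℝ} (ht : t ∈ unitCube d) :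
    anchoredBox t ⊆ unitCube d := fun _ hz =>
  ⟨fun j => (hz j (Set.mem_univ j)).1, fun j => (hz j (Set.mem_univ j)).2.le.trans (ht.2 j)⟩

lemma measurableSet_unitCube : MeasurableSet (unitCube d) := measurableSet_Icc

lemma measurableSet_anchoredBox (t : Fin d → ℝ) : MeasurableSet (anchoredBox t) :=
  MeasurableSet.univ_pi fun _ => measurableSet_Ico

lemma IsUnnormalizedDensity.integral_anchoredBox_le {ψ : (Fin d → ℝ) → ℝ}
    (hψ : IsUnnormalizedDensity ψ) {t : Fin d → ℝ} (ht : t ∈ unitCube d) :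
    ∫ z in anchoredBox t, ψ z ≤ ∫ z in unitCube d, ψ z :=
  setIntegral_mono_set hψ.integrableOn
    ((ae_restrict_iff' measurableSet_unitCube).2 (Filter.Eventually.of_forall hψ.nonneg))
    (anchoredBox_subset_unitCube ht).eventuallyLE

lemma abs_localDiscrepancy_le_starDiscrepancy {ι : Type*} [Fintype ι] {ψ : (Fin d → ℝ) → ℝ}
    (hψ : IsUnnormalizedDensity ψ) (y : ι → Fin d → ℝ) {t : Fin d → ℝ} (ht : t ∈ unitCube d) :
    |localDiscrepancy ψ y t| ≤ starDiscrepancy ψ y := by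
  refine le_ciSup (f := fun t : unitCube d => |localDiscrepancy ψ y t|) ?_ ⟨t, ht⟩
  refine ⟨1 + 1, ?_⟩
  rintro _ ⟨⟨t, ht⟩, rfl⟩
  refine (abs_sub _ _).trans (add_le_add ?_ ?_)
  · have h0 : 0 ≤ ∑ n, (anchoredBox t).indicator (fun _ => (1 : ℝ)) (y n) :=
      Finset.sum_nonneg fun _ _ => Set.indicator_nonneg (fun _ _ => zero_le_one) _
    have h1 : ∑ n, (anchoredBox t).indicator (fun _ => (1 : ℝ)) (y n) ≤ Fintype.card ι := by
      refine (Finset.sum_le_card_nsmul _ _ 1 fun n _ => ?_).trans_eq (by simp)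
      exact Set.indicator_le_self' (fun _ _ => zero_le_one) _
    rw [abs_of_nonneg (by positivity), one_div_mul_eq_div]
    exact div_le_one_of_le₀ h1 (by positivity)
  · have h0 : 0 ≤ ∫ z in anchoredBox t, ψ z :=
      setIntegral_nonneg (measurableSet_anchoredBox t) fun z hz =>
        hψ.nonneg z (anchoredBox_subset_unitCube ht hz)
    have hC := hψ.integral_pos
    rw [abs_of_nonneg (by positivity), one_div_mul_eq_div]
    exact div_le_one_of_le₀ (hψ.integral_anchoredBox_le ht) hC.le

/-! ### The local discrepancy at the corner of a half cube -/

/-- The point with coordinate `1 / 2` at `j₀` and all other coordinates `1`. -/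
noncomputable def halfCorner (j₀ : Fin d) : Fin d → ℝ := Function.update 1 j₀ (1 / 2)

lemma halfCorner_mem (j₀ : Fin d) : halfCorner j₀ ∈ unitCube d := by
  constructor <;> intro j <;> by_cases h : j = j₀
  · subst h; simp [halfCorner]
  · simp [halfCorner, h]
  · subst h; simp [halfCorner]; norm_num
  · simp [halfCorner, h]

lemma lt_half_of_mem {j₀ : Fin d} {z : Fin d → ℝ} (hz : z ∈ anchoredBox (halfCorner j₀)) :
    z j₀ < 1 / 2 := by
  have := (hz j₀ (Set.mem_univ _)).2
  simpa [halfCorner] using this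

lemma volume_halfBox (j₀ : Fin d) : volume.real (anchoredBox (halfCorner j₀)) = 1 / 2 := by
  rw [Measure.real, anchoredBox, volume_pi_pi, ENNReal.toReal_prod]
  simp only [Real.volume_Ico, sub_zero]
  rw [Finset.prod_eq_single j₀]
  · simp [halfCorner]
  · intro j _ hj; simp [halfCorner, hj]
  · simp

lemma integral_halfBox {j₀ : Fin d} {ψ : (Fin d → ℝ) → ℝ}
    (h1 : ∀ z ∈ unitCube d, z j₀ ≤ 1 / 2 → ψ z = 1) :
    ∫ z in anchoredBox (halfCorner j₀), ψ z = 1 / 2 := by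
  rw [setIntegral_congr_fun (g := fun _ => (1 : ℝ)) (measurableSet_anchoredBox _) fun z hz =>
    h1 z (anchoredBox_subset_unitCube (halfCorner_mem j₀) hz) (lt_half_of_mem hz).le]
  simp [volume_halfBox]

/-- The number of driver points that project into the half box `[0, halfCorner j₀)`. Points having
some other coordinate equal to `1` are not counted, as the box is half-open. -/
noncomputable def halfCount {M : ℕ} (j₀ : Fin d) (x : Fin M → Fin (d + 1) → ℝ) : ℕ :=
  open Classical in
  (Finset.univ.filter fun n => firstCoords (x n) ∈ anchoredBox (halfCorner j₀)).card

variable {M : ℕ} {j₀ : Fin d} {x : Fin M → Fin (d + 1) → ℝ} {ψ : (Fin d → ℝ) → ℝ}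

lemma firstCoords_mem {p : Fin (d + 1) → ℝ} (hp : p ∈ unitCube (d + 1)) :
    firstCoords p ∈ unitCube d := ⟨fun j => hp.1 j.castSucc, fun j => hp.2 j.castSucc⟩

lemma mem_accepted_of_mem_halfBox (h1 : ∀ z ∈ unitCube d, z j₀ ≤ 1 / 2 → ψ z = 1)
    (hx : ∀ n, x n ∈ unitCube (d + 1)) {n : Fin M}
    (hn : firstCoords (x n) ∈ anchoredBox (halfCorner j₀)) : n ∈ accepted ψ 1 x := by
  rw [accepted, Finset.mem_filter, h1 _ (firstCoords_mem (hx n)) (lt_half_of_mem hn).le, one_mul]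
  exact ⟨Finset.mem_univ n, (hx n).2 _⟩

lemma halfCount_le_card_accepted (h1 : ∀ z ∈ unitCube d, z j₀ ≤ 1 / 2 → ψ z = 1)
    (hx : ∀ n, x n ∈ unitCube (d + 1)) : halfCount j₀ x ≤ (accepted ψ 1 x).card :=
  Finset.card_le_card fun _ hn =>
    mem_accepted_of_mem_halfBox h1 hx (by classical exact (Finset.mem_filter.1 hn).2)

lemma localDiscrepancy_halfCorner (h1 : ∀ z ∈ unitCube d, z j₀ ≤ 1 / 2 → ψ z = 1)
    (hx : ∀ n, x n ∈ unitCube (d + 1)) :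
    localDiscrepancy ψ (samples ψ 1 x) (halfCorner j₀) =
      halfCount j₀ x / (accepted ψ 1 x).card - 1 / 2 / ∫ z in unitCube d, ψ z := by
  classical
  have hsum : ∑ n, (anchoredBox (halfCorner j₀)).indicator (fun _ => (1 : ℝ)) (samples ψ 1 x n) =
      halfCount j₀ x := by
    refine (Finset.sum_coe_sort (accepted ψ 1 x) fun n => (anchoredBox (halfCorner j₀)).indicator
      (fun _ => (1 : ℝ)) (firstCoords (x n))).trans ?_
    rw [Finset.sum_subset (Finset.subset_univ _)]
    · simp [Set.indicator_apply, halfCount]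
    · intro n _ hn
      exact Set.indicator_of_notMem (fun h => hn (mem_accepted_of_mem_halfBox h1 hx h)) _
  rw [localDiscrepancy, hsum, integral_halfBox h1, Fintype.card_coe]
  ring

lemma integral_mem_Icc_of_eq_one (hψ : ∀ z ∈ unitCube d, 0 ≤ ψ z) (hle : ∀ z, ψ z ≤ 1)
    (hint : IntegrableOn ψ (unitCube d))
    (h1 : ∀ z ∈ unitCube d, z j₀ ≤ 1 / 2 → ψ z = 1) :
    (∫ z in unitCube d, ψ z) ∈ Set.Icc (1 / 2 : ℝ) 1 := by
  constructor
  · rw [← integral_halfBox h1]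
    exact setIntegral_mono_set hint
      ((ae_restrict_iff' measurableSet_unitCube).2 (Filter.Eventually.of_forall hψ))
      (anchoredBox_subset_unitCube (halfCorner_mem j₀)).eventuallyLE
  · have hv : volume.real (unitCube d) = 1 := by
      rw [Measure.real, unitCube, Real.volume_Icc_pi_toReal zero_le_one]
      simp
    have hfin : volume (unitCube d) ≠ ⊤ := isCompact_Icc.measure_lt_top.ne
    calc ∫ z in unitCube d, ψ z ≤ ∫ _z in unitCube d, (1 : ℝ) :=
          setIntegral_mono hint (integrableOn_const hfin) hle
      _ = 1 := by simp [hv]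

end Discrepancy

/-! ### Comparing the cut and the uncut dome -/

section Comparison
variable {d k M : ℕ} {j₀ : Fin d} {x : Fin M → Fin (d + 1) → ℝ}

lemma integral_cutDome_mem_Icc (A : Finset (Fin d → Fin k)) :
    (∫ z in unitCube d, cutDome j₀ A z) ∈ Set.Icc (1 / 2 : ℝ) 1 :=
  integral_mem_Icc_of_eq_one (j₀ := j₀) (fun _ => cutDome_nonneg A) (cutDome_le_one A)
    (integrableOn_cutDome A) fun _ => cutDome_eq_one A

lemma isUnnormalizedDensity_cutDome (A : Finset (Fin d → Fin k)) :
    IsUnnormalizedDensity (cutDome j₀ A) where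
  nonneg _ := cutDome_nonneg A
  integrableOn := integrableOn_cutDome A
  integral_pos := half_pos one_pos |>.trans_le (integral_cutDome_mem_Icc A).1

lemma isLUB_image_cutDome (A : Finset (Fin d → Fin k)) :
    IsLUB (cutDome j₀ A '' unitCube d) 1 := by
  refine IsGreatest.isLUB ⟨⟨0, ⟨le_rfl, zero_le_one⟩, ?_⟩, ?_⟩
  · exact cutDome_eq_one A ⟨le_rfl, zero_le_one⟩ (by simp)
  · rintro _ ⟨z, -, rfl⟩
    exact cutDome_le_one A z

/-- The discrepancy bound with denominators cleared: for every set of caps, the absolute value of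
`N / 2 - m * C` is at most `N` times the star discrepancy. The quantity is linear in
the pair `(N, C)`, so that the bounds for two sets of caps can be subtracted. -/
lemma abs_count_sub_le (hx : ∀ n, x n ∈ unitCube (d + 1)) (A : Finset (Fin d → Fin k)) :
    |((accepted (cutDome j₀ A) 1 x).card : ℝ) / 2 -
      halfCount j₀ x * ∫ z in unitCube d, cutDome j₀ A z| ≤
    (accepted (cutDome j₀ A) 1 x).card *
      starDiscrepancy (cutDome j₀ A) (samples (cutDome j₀ A) 1 x) := by
  have hstar := abs_localDiscrepancy_le_starDiscrepancy
    (isUnnormalizedDensity_cutDome (j₀ := j₀) A) (samples (cutDome j₀ A) 1 x) (halfCorner_mem j₀)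
  rw [localDiscrepancy_halfCorner (fun _ => cutDome_eq_one A) hx] at hstar
  have hle := halfCount_le_card_accepted (ψ := cutDome j₀ A) (fun _ => cutDome_eq_one A) hx
  obtain ⟨hC0, hC1⟩ := integral_cutDome_mem_Icc (j₀ := j₀) A
  set N := (accepted (cutDome j₀ A) 1 x).card
  set C := ∫ z in unitCube d, cutDome j₀ A z
  set m := halfCount j₀ x
  rcases Nat.eq_zero_or_pos N with hN | hN
  · have hm : m = 0 := by omega
    simp [hN, hm]
  · have hN : (0 : ℝ) < N := by exact_mod_cast hN
    have : (N : ℝ) / 2 - m * C = - (N * C * ((m : ℝ) / N - 1 / 2 / C)) := by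
      have : C ≠ 0 := by linarith
      field_simp
      ring
    rw [this, abs_neg, abs_mul, abs_of_nonneg (mul_nonneg hN.le (by linarith)), mul_assoc]
    refine mul_le_mul_of_nonneg_left ?_ hN.le
    exact (mul_le_of_le_one_left (abs_nonneg _) hC1).trans hstar

lemma accepted_cutDome_anti {A B : Finset (Fin d → Fin k)} (h : A ⊆ B) :
    accepted (cutDome j₀ B) 1 x ⊆ accepted (cutDome j₀ A) 1 x :=
  Finset.monotone_filter_right _ fun _ _ hn => hn.trans (cutDome_anti h _)

/-- There is a set of at least half of all caps whose removal either changes no acceptance (caps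
free of accepted points) or rejects at least as many points as there are caps in the set (each of
these disjoint caps contains a point). -/
lemma exists_caps (j₀ : Fin d) (k : ℕ) (x : Fin M → Fin (d + 1) → ℝ) :
    ∃ A : Finset (Fin d → Fin k), k ^ d ≤ 2 * A.card ∧
      ((accepted (cutDome j₀ A) 1 x).card =
          (accepted (cutDome j₀ (∅ : Finset (Fin d → Fin k))) 1 x).card ∨
        (accepted (cutDome j₀ A) 1 x).card + A.card ≤
          (accepted (cutDome j₀ (∅ : Finset (Fin d → Fin k))) 1 x).card) := by
  classical
  let E : Finset (Fin M) := accepted (cutDome j₀ (∅ : Finset (Fin d → Fin k))) 1 x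
  let hit (i : Fin d → Fin k) : Prop :=
    ∃ n ∈ E, capPlane j₀ i (firstCoords (x n)) < x n (Fin.last d)
  have hcard : (Finset.univ.filter hit).card + (Finset.univ.filter fun i => ¬ hit i).card =
      k ^ d := by
    rw [Finset.card_filter_add_card_filter_not]
    simp
  rcases le_total (Finset.univ.filter hit).card (Finset.univ.filter fun i => ¬ hit i).card
    with h | h
  · refine ⟨Finset.univ.filter fun i => ¬ hit i, by omega, Or.inl ?_⟩
    refine congrArg _ (Finset.Subset.antisymm (accepted_cutDome_anti (Finset.empty_subset _)) ?_)
    intro n hn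
    refine Finset.mem_filter.2 ⟨Finset.mem_univ n, le_cutDome.2
      ⟨(le_cutDome.1 (Finset.mem_filter.1 hn).2).1, fun i hi => ?_⟩⟩
    rw [one_mul]
    exact not_lt.1 fun hlt => (Finset.mem_filter.1 hi).2 ⟨n, hn, hlt⟩
  · refine ⟨Finset.univ.filter hit, by omega, Or.inr ?_⟩
    set A := Finset.univ.filter hit
    have hA : ∀ i : A, hit i := fun i => (Finset.mem_filter.1 i.2).2
    choose f hfE hf using hA
    have hdome (n : Fin M) (hn : n ∈ E) : x n (Fin.last d) ≤ dome j₀ (firstCoords (x n)) := by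
      have := (le_cutDome.1 (Finset.mem_filter.1 hn).2).1.2
      rwa [one_mul] at this
    have hinj : Function.Injective f := by
      intro i i' hii
      refine Subtype.ext (eq_of_abs_sub_capCenter_lt
        (abs_sub_lt_of_capPlane_lt ((hf i).trans_le (hdome _ (hfE i)))) ?_)
      rw [hii]
      exact abs_sub_lt_of_capPlane_lt ((hf i').trans_le (hdome _ (hfE i')))
    have h1 : A.card ≤ (E \ accepted (cutDome j₀ A) 1 x).card := by
      rw [← Fintype.card_coe A, ← Finset.card_univ, ← Finset.card_image_of_injective _ hinj]
      refine Finset.card_le_card fun n hn => ?_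
      obtain ⟨i, -, rfl⟩ := Finset.mem_image.1 hn
      refine Finset.mem_sdiff.2 ⟨hfE i, fun hacc => ?_⟩
      have := (le_cutDome.1 (Finset.mem_filter.1 hacc).2).2 i i.2
      rw [one_mul] at this
      exact absurd this (not_le.2 (hf i))
    have h2 := Finset.card_sdiff_add_card_eq_card
      (accepted_cutDome_anti (j₀ := j₀) (x := x) (Finset.empty_subset A))
    change (E \ _).card + _ = E.card at h2
    change _ ≤ E.card
    omega

end Comparison

/-! ### The choice of scale and the lower bound -/

section LowerBound
variable {d k M : ℕ} {j₀ : Fin d} {x : Fin M → Fin (d + 1) → ℝ}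

lemma mul_capRadius_pow (hk : 0 < k) (n : ℕ) : (k : ℝ) ^ n * capRadius k ^ n = (3 / 16) ^ n := by
  have : (k : ℝ) ≠ 0 := by positivity
  rw [← mul_pow, capRadius]
  congr 1
  field_simp

/-- For `m ≤ k ^ (d + 2)`, the upper bound for the volume of a cap is at most `1 / (4 m)`. -/
lemma mul_capVolume_upper_le (hk : 0 < k) (hd : 1 ≤ d) {m : ℝ} (hm : m ≤ (k : ℝ) ^ (d + 2)) :
    m * (capRadius k ^ 2 / (2 * d) * (2 * capRadius k) ^ d) ≤ 1 / 4 := by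
  have hd' : (1 : ℝ) ≤ d := by exact_mod_cast hd
  have hr := capRadius_pos hk
  calc m * (capRadius k ^ 2 / (2 * d) * (2 * capRadius k) ^ d)
      ≤ (k : ℝ) ^ (d + 2) * (capRadius k ^ 2 / (2 * d) * (2 * capRadius k) ^ d) :=
        mul_le_mul_of_nonneg_right hm (by positivity)
    _ = ((k : ℝ) ^ (d + 2) * capRadius k ^ (d + 2)) * 2 ^ d / (2 * d) := by rw [mul_pow]; ring
    _ = (9 / 256 * (3 / 8) ^ d) / (2 * d) := by
        rw [mul_capRadius_pow hk, show (3 / 8 : ℝ) = 3 / 16 * 2 by norm_num, mul_pow]; ring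
    _ ≤ 1 / 4 := by
        have : (3 / 8 : ℝ) ^ d ≤ 1 := pow_le_one₀ (by norm_num) (by norm_num)
        exact div_le_of_le_mul₀ (by positivity) (by norm_num) (by linarith)

/-- For `k ^ (d + 2) ≤ 2 ^ (d + 2) * m`, the lower bound for the volume of a cap is at least a
constant times `1 / m`. -/
lemma le_mul_capVolume_lower (hk : 0 < k) (hd : 1 ≤ d) {m : ℝ}
    (hm : (k : ℝ) ^ (d + 2) ≤ 2 ^ (d + 2) * m) :
    (3 / 32) ^ (d + 2) / (4 * d ^ (d + 1)) ≤
      m * (capRadius k ^ 2 / (4 * d) * (capRadius k / d) ^ d) := by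
  have hd' : (0 : ℝ) < d := by exact_mod_cast hd
  have hr := capRadius_pos hk
  calc (3 / 32 : ℝ) ^ (d + 2) / (4 * d ^ (d + 1))
      = ((k : ℝ) ^ (d + 2) * capRadius k ^ (d + 2)) / 2 ^ (d + 2) / (4 * d ^ (d + 1)) := by
        rw [mul_capRadius_pow hk, ← div_pow]; norm_num
    _ = (k : ℝ) ^ (d + 2) / 2 ^ (d + 2) * (capRadius k ^ 2 / (4 * d) * (capRadius k / d) ^ d) := by
        rw [div_pow]; field_simp; ring
    _ ≤ m * (capRadius k ^ 2 / (4 * d) * (capRadius k / d) ^ d) :=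
        mul_le_mul_of_nonneg_right (by rw [div_le_iff₀ (by positivity)]; linarith) (by positivity)

lemma constant_density_of_halfCount_eq_zero (hx : ∀ n, x n ∈ unitCube (d + 1))
    (hm : halfCount j₀ x = 0) :
    IsUnnormalizedDensity (fun _ : Fin d → ℝ => (1 : ℝ)) ∧
      (accepted (fun _ => 1) 1 x).card = M ∧
      1 / 2 ≤ starDiscrepancy (fun _ => 1) (samples (fun _ => 1) 1 x) := by
  have hint : IntegrableOn (fun _ : Fin d → ℝ => (1 : ℝ)) (unitCube d) :=
    integrableOn_const isCompact_Icc.measure_lt_top.ne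
  obtain ⟨h0, h1⟩ := integral_mem_Icc_of_eq_one (j₀ := j₀) (ψ := fun _ => 1)
    (fun _ _ => zero_le_one) (fun _ => le_rfl) hint (fun _ _ _ => rfl)
  have hψ : IsUnnormalizedDensity (fun _ : Fin d → ℝ => (1 : ℝ)) :=
    ⟨fun _ _ => zero_le_one, hint, by linarith⟩
  refine ⟨hψ, ?_, ?_⟩
  · rw [accepted, Finset.filter_true_of_mem fun n _ => by rw [one_mul]; exact (hx n).2 _,
      Finset.card_univ, Fintype.card_fin]
  · refine le_trans ?_ (abs_localDiscrepancy_le_starDiscrepancy hψ _ (halfCorner_mem j₀))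
    rw [localDiscrepancy_halfCorner (fun _ _ _ => rfl) hx, hm, Nat.cast_zero, zero_div, zero_sub,
      abs_neg, abs_of_nonneg (by positivity)]
    rw [le_div_iff₀ (by linarith)]
    linarith

/-- If some driver point lies above the half box, then the truncated dome, with either no caps
removed or those of `exists_caps` removed, has large discrepancy. -/
lemma exists_cutDome_discrepancy (j₀ : Fin d) (hx : ∀ n, x n ∈ unitCube (d + 1))
    (hm : 1 ≤ halfCount j₀ x) {c : ℝ} (hc0 : 0 < c) (hc : c < 1 / 64)
    (hc1 : c < (3 / 32) ^ (d + 2) / (4 * d ^ (d + 1)) / 16) :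
    ∃ (k : ℕ) (A : Finset (Fin d → Fin k)),
      c * ((accepted (cutDome j₀ A) 1 x).card : ℝ) ^ (-(2 / (((d + 1 : ℕ) : ℝ) + 1))) ≤
        starDiscrepancy (cutDome j₀ A) (samples (cutDome j₀ A) 1 x) := by
  set m := halfCount j₀ x with hmdef
  have hm1 : (1 : ℝ) ≤ m := by exact_mod_cast hm
  have hd : 1 ≤ d := j₀.pos
  set e : ℝ := 2 / (((d + 1 : ℕ) : ℝ) + 1) with he
  have he0 : 0 ≤ e := by positivity
  -- In terms of `r` the powers are integral: `m = r ^ (d + 2)` and `m ^ (-e) = (r ^ 2)⁻¹`.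
  set r : ℝ := (m : ℝ) ^ (((d + 2 : ℕ) : ℝ)⁻¹) with hr
  have hr1 : 1 ≤ r := Real.one_le_rpow hm1 (by positivity)
  have hrm : r ^ (d + 2) = m := Real.rpow_inv_natCast_pow (by linarith) (by omega)
  have hme : (m : ℝ) ^ (-e) = (r ^ 2)⁻¹ := by
    rw [Real.rpow_neg (by linarith), ← Real.rpow_natCast r 2, hr, ← Real.rpow_mul (by linarith)]
    congr 2
    rw [he]; push_cast; field_simp; ring
  set k := ⌈r⌉₊ with hkdef
  have hrk : r ≤ k := Nat.le_ceil r
  have hk2 : (k : ℝ) ≤ 2 * r := by have := Nat.ceil_lt_add_one (a := r) (by linarith); linarith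
  have hk : 0 < k := Nat.ceil_pos.2 (by linarith)
  have hku : (m : ℝ) ≤ (k : ℝ) ^ (d + 2) := by
    rw [← hrm]; exact pow_le_pow_left₀ (by linarith) hrk _
  have hkl : (k : ℝ) ^ (d + 2) ≤ 2 ^ (d + 2) * m := by
    rw [← hrm, ← mul_pow]; exact pow_le_pow_left₀ (by positivity) hk2 _
  obtain ⟨A, hA, hR⟩ := exists_caps j₀ k x
  by_contra! hcon
  have h0 := hcon k ∅
  have h1 := hcon k A
  have b0 := abs_count_sub_le (j₀ := j₀) hx (∅ : Finset (Fin d → Fin k))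
  have b1 := abs_count_sub_le (j₀ := j₀) hx A
  have m0 : m ≤ (accepted (cutDome j₀ (∅ : Finset (Fin d → Fin k))) 1 x).card :=
    halfCount_le_card_accepted (fun _ => cutDome_eq_one _) hx
  have m1 : m ≤ (accepted (cutDome j₀ A) 1 x).card :=
    halfCount_le_card_accepted (fun _ => cutDome_eq_one _) hx
  have vU := integral_cutDome_ge (j₀ := j₀) A hk
  have vL := integral_cutDome_le (j₀ := j₀) A hk
  have u := mul_capVolume_upper_le hk hd hku
  have w := le_mul_capVolume_lower hk hd hkl
  obtain ⟨-, C1⟩ := integral_cutDome_mem_Icc (j₀ := j₀) (∅ : Finset (Fin d → Fin k))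
  rw [← hmdef] at b0 b1
  set N0 := (accepted (cutDome j₀ (∅ : Finset (Fin d → Fin k))) 1 x).card
  set N1 := (accepted (cutDome j₀ A) 1 x).card
  set D0 := starDiscrepancy (cutDome j₀ (∅ : Finset (Fin d → Fin k)))
    (samples (cutDome j₀ (∅ : Finset (Fin d → Fin k))) 1 x)
  set D1 := starDiscrepancy (cutDome j₀ A) (samples (cutDome j₀ A) 1 x)
  set I0 := ∫ z in unitCube d, cutDome j₀ (∅ : Finset (Fin d → Fin k)) z
  set I1 := ∫ z in unitCube d, cutDome j₀ A z
  set U := capRadius k ^ 2 / (2 * d : ℝ) * (2 * capRadius k) ^ d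
  set W := capRadius k ^ 2 / (4 * d : ℝ) * (capRadius k / d) ^ d
  set c₁ : ℝ := (3 / 32) ^ (d + 2) / (4 * d ^ (d + 1))
  have N10 : (N1 : ℝ) ≤ N0 := by have : N1 ≤ N0 := by omega
                                 exact_mod_cast this
  have m0 : (m : ℝ) ≤ N0 := by exact_mod_cast m0
  have m1 : (m : ℝ) ≤ N1 := by exact_mod_cast m1
  have hAr : r ^ d / 2 ≤ (A.card : ℝ) := by
    have h : ((k : ℝ)) ^ d ≤ 2 * A.card := by exact_mod_cast hA
    have := pow_le_pow_left₀ (by linarith : 0 ≤ r) hrk d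
    linarith
  have hpow (N : ℕ) (hN : (m : ℝ) ≤ N) : c * (N : ℝ) ^ (-e) ≤ c * (r ^ 2)⁻¹ := by
    rw [← hme]
    exact mul_le_mul_of_nonneg_left
      (Real.rpow_le_rpow_of_nonpos (by linarith) hN (by linarith)) hc0.le
  have d0 : D0 < c * (r ^ 2)⁻¹ := h0.trans_le (hpow N0 m0)
  have d1 : D1 < c * (r ^ 2)⁻¹ := h1.trans_le (hpow N1 m1)
  -- If `N0 > 4 m`, too few of the accepted points lie above the half box, and `D0 ≥ 1 / 4`.
  have hN04 : (N0 : ℝ) ≤ 4 * m := by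
    by_contra! hlt
    have hD : D0 < 1 / 4 := by
      have : (r ^ 2)⁻¹ ≤ 1 := inv_le_one_of_one_le₀ (one_le_pow₀ hr1)
      nlinarith
    have b := (le_abs_self _).trans b0
    have h3 : (m : ℝ) * I0 ≤ m := mul_le_of_le_one_right (by linarith) C1
    have h4 := mul_lt_mul_of_pos_left hD (show (0 : ℝ) < N0 by linarith)
    linarith
  have hδ : 4 * m * (c * (r ^ 2)⁻¹) = 4 * c * r ^ d := by
    rw [← hrm, pow_add]
    field_simp
  have hrd : 0 < r ^ d := by positivity
  have e0 : (N0 : ℝ) * D0 ≤ 4 * c * r ^ d := by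
    rw [← hδ]
    exact (mul_le_mul_of_nonneg_left d0.le (by linarith)).trans
      (mul_le_mul_of_nonneg_right hN04 (by positivity))
  have e1 : (N1 : ℝ) * D1 ≤ 4 * c * r ^ d := by
    rw [← hδ]
    exact (mul_le_mul_of_nonneg_left d1.le (by linarith)).trans
      (mul_le_mul_of_nonneg_right (N10.trans hN04) (by positivity))
  have vU' := mul_le_mul_of_nonneg_left vU (show (0 : ℝ) ≤ m by linarith)
  have vL' := mul_le_mul_of_nonneg_left vL (show (0 : ℝ) ≤ m by linarith)
  have u' := mul_le_mul_of_nonneg_left u (Nat.cast_nonneg (α := ℝ) A.card)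
  have w' := mul_le_mul_of_nonneg_left w (Nat.cast_nonneg (α := ℝ) A.card)
  -- Subtract the two bounds: `N / 2 - m C` changes only through `C` in the first case; in the
  -- second, `N / 2` drops by at least `A.card / 2` and `m C` by at most `A.card / 4`.
  rcases hR with hR | hR
  · have hR : (N1 : ℝ) = N0 := by exact_mod_cast hR
    have f0 := (neg_le_abs _).trans (b0.trans e0)
    have f1 := (le_abs_self _).trans (b1.trans e1)
    have g : r ^ d / 2 * c₁ ≤ A.card * c₁ :=
      mul_le_mul_of_nonneg_right hAr (by linarith)
    have g2 : r ^ d * (c₁ / 16) ≤ r ^ d * c := by linarith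
    exact absurd (le_of_mul_le_mul_left g2 hrd) (not_le.2 hc1)
  · have hR : (N1 : ℝ) + A.card ≤ N0 := by exact_mod_cast hR
    have f0 := (le_abs_self _).trans (b0.trans e0)
    have f1 := (neg_le_abs _).trans (b1.trans e1)
    have g2 : r ^ d * (1 / 64) ≤ r ^ d * c := by linarith
    exact absurd (le_of_mul_le_mul_left g2 hrd) (not_le.2 hc)

end LowerBound

/-- Here `s = d + 1 ≥ 2` is the dimension of the driver points. -/
theorem theorem2 (d : ℕ) (hd : 1 ≤ d) :
    ∃ c : ℝ, 0 < c ∧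
      ∀ (M : ℕ), 1 ≤ M → ∀ x : Fin M → Fin (d + 1) → ℝ, (∀ n, x n ∈ unitCube (d + 1)) →
        ∃ (ψ : (Fin d → ℝ) → ℝ) (L : ℝ),
          IsUnnormalizedDensity ψ ∧ ConcaveOn ℝ (unitCube d) ψ ∧
          IsLUB (ψ '' unitCube d) L ∧
          1 ≤ (accepted ψ L x).card ∧
          c * ((accepted ψ L x).card : ℝ) ^ (-(2 / (((d + 1 : ℕ) : ℝ) + 1))) ≤
            starDiscrepancy ψ (samples ψ L x) := by
  have hd' : (0 : ℝ) < d := by exact_mod_cast hd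
  obtain ⟨c, hc0, hc⟩ := exists_between (show (0 : ℝ) <
    min (1 / 64 : ℝ) ((3 / 32 : ℝ) ^ (d + 2) / (4 * (d : ℝ) ^ (d + 1)) / 16) from
    lt_min (by norm_num) (by positivity))
  obtain ⟨hc64, hc1⟩ := lt_min_iff.1 hc
  have hconv : Convex ℝ (unitCube d) := convex_Icc 0 1
  refine ⟨c, hc0, fun M hM x hx => ?_⟩
  rcases Nat.eq_zero_or_pos (halfCount ⟨0, hd⟩ x) with hm | hm
  · obtain ⟨hψ, hcard, hstar⟩ := constant_density_of_halfCount_eq_zero hx hm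
    refine ⟨fun _ => 1, 1, hψ, concaveOn_const 1 hconv, ?_, hcard.symm ▸ hM, ?_⟩
    · rw [Set.Nonempty.image_const (show (unitCube d).Nonempty from ⟨0, le_rfl, zero_le_one⟩)]
      exact isLUB_singleton
    · refine le_trans ?_ hstar
      rw [hcard]
      have : (M : ℝ) ^ (-(2 / (((d + 1 : ℕ) : ℝ) + 1))) ≤ 1 :=
        Real.rpow_le_one_of_one_le_of_nonpos (by exact_mod_cast hM)
          (neg_nonpos.2 (by positivity))
      nlinarith
  · obtain ⟨k, A, hA⟩ := exists_cutDome_discrepancy ⟨0, hd⟩ hx hm hc0 hc64 hc1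
    exact ⟨cutDome ⟨0, hd⟩ A, 1, isUnnormalizedDensity_cutDome A,
      concaveOn_cutDome A _ hconv, isLUB_image_cutDome A,
      hm.trans_le (halfCount_le_card_accepted (fun _ => cutDome_eq_one A) hx), hA⟩
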